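/- Let $a,T,D\in\mathbb{R}$ with $a^2+D^2\neq 0$, let $W(y)=Dy^2-aTy+a^2$, and consider the planar linear system $\dot x=Tx-y$, $\dot y=Dx-a$ with the section $\Sigma=\{x=0\}$. For $y_0\ge 0$ let $(\Phi_1(t;y_0),\Phi_2(t;y_0))$ be the solution with initial condition $(0,y_0)$ at $t=0$. The left Poincaré half-map $P:I\subset[0,+\infty)\to(-\infty,0]$ is defined as follows: if there is $\tau=\tau(y_0)>0$ with $\Phi_1(\tau;y_0)=0$ and $\Phi_1(t;y_0)<0$ for all $t\in(0,\tau)$, then $y_0\in I$ and $P(y_0)=\Phi_2(\tau;y_0)$; moreover, if $P(0)$ is not defined in this way but for every $\varepsilon>0$ there are $u\in(0,\varepsilon)\cap I$ with $P(u)\in(-\varepsilon,0)$, then $0\in I$ and $P(0)=0$; no other points belong to $I$. Assume that $0\in I$ and $P(0)=\hat y_1<0$. Then $a<0$, $T>0$ and $4D-T^2>0$. Moreover, $I$ is an interval containing a right neighbourhood of $0$ in $[0,+\infty)$, $P(I)$ is an interval whose right endpoint is $\hat y_1$ (which belongs to $P(I)$), $P$ is real analytic in $I$ (at the endpoint $0$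 this means that $P$ coincides, on a right neighbourhood of $0$, with a convergent power series), and as $y_0\to 0$, $y_0\ge 0$, $$ \begin{aligned} P(y_0)={}&\hat y_1+\frac{W(\hat y_1)\,y_0^2}{2a^2\hat y_1}+\frac{T\,W(\hat y_1)\,y_0^3}{3a^3\hat y_1}-\frac{\left(a^2+(D-2T^2)\hat y_1^2\right)W(\hat y_1)\,y_0^4}{8a^4\hat y_1^3}\\ &-\frac{T\left(5a^2+(7D-6T^2)\hat y_1^2\right)W(\hat y_1)\,y_0^5}{30a^5\hat y_1^3}\\ &+\frac{\left(9a^4-6a^3T\hat y_1+2a^2(9D-13T^2)\hat y_1^2+(9D^2-46DT^2+24T^4)\hat y_1^4\right)W(\hat y_1)\,y_0^6}{144a^6\hat y_1^5}+\mathcal O(y_0^7). \end{aligned} $$ -/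

import Mathlib

open Set Filter Topology Asymptotics

/-- The pair `(x, y)` is a (global) solution of the planar linear system in generalized Liénard form
`x' = T x - y`, `y' = D x - a`. -/
def IsLienardSolution (T D a : ℝ) (x y : ℝ → ℝ) : Prop :=
  ∀ t : ℝ, HasDerivAt x (T * x t - y t) t ∧ HasDerivAt y (D * x t - a) t

/-- The orbit that starts at the point `(0, y₀)` of the section `x = 0` stays in the open half-plane
`x < 0` for the times in `(0, τ)`, and is back on the section at the time `τ > 0`, at the point
`(0, y₁)`. So `τ` is the left flight time of `y₀`. -/
def IsLeftReturn (T D a y₀ τ y₁ : ℝ) : Prop :=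
  0 < τ ∧ ∃ x y : ℝ → ℝ, IsLienardSolution T D a x y ∧ x 0 = 0 ∧ y 0 = y₀ ∧
    x τ = 0 ∧ (∀ t ∈ Ioo 0 τ, x t < 0) ∧ y τ = y₁

/-- The solution of the system with given initial condition is unique. -/
theorem IsLienardSolution.unique {T D a : ℝ} {x y u v : ℝ → ℝ}
    (h₁ : IsLienardSolution T D a x y) (h₂ : IsLienardSolution T D a u v)
    (hx : x 0 = u 0) (hy : y 0 = v 0) : x = u ∧ y = v := by
  let L : ℝ × ℝ →L[ℝ] ℝ × ℝ :=
    (T • ContinuousLinearMap.fst ℝ ℝ ℝ - ContinuousLinearMap.snd ℝ ℝ ℝ).prod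
      (D • ContinuousLinearMap.fst ℝ ℝ ℝ)
  have hL : ∀ t : ℝ, LipschitzOnWith ‖L‖₊ (fun p : ℝ × ℝ => L p - (0, a)) univ := by
    intro t
    have h : LipschitzWith ‖L‖₊ (fun p : ℝ × ℝ => L p - (0, a)) := by
      refine LipschitzWith.of_dist_le_mul fun p q => ?_
      rw [dist_sub_right]
      exact L.lipschitz.dist_le_mul p q
    exact h.lipschitzOnWith
  have key : ∀ {x y : ℝ → ℝ}, IsLienardSolution T D a x y →
      ∀ t, HasDerivAt (fun t => (x t, y t)) (L (x t, y t) - (0, a)) t ∧ (x t, y t) ∈ univ := by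
    intro x y h t
    refine ⟨?_, mem_univ _⟩
    have := (h t).1.prodMk (h t).2
    simpa [L] using this
  have h := ODE_solution_unique_univ (t₀ := 0) hL (key h₁) (key h₂) (by simp [hx, hy])
  exact ⟨funext fun t => congrArg Prod.fst (congrFun h t),
    funext fun t => congrArg Prod.snd (congrFun h t)⟩

/-- The left flight time and the point of return are determined by the starting point. -/
theorem IsLeftReturn.unique {T D a y₀ τ y₁ σ z₁ : ℝ} (h₁ : IsLeftReturn T D a y₀ τ y₁)
    (h₂ : IsLeftReturn T D a y₀ σ z₁) : τ = σ ∧ y₁ = z₁ := by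
  obtain ⟨hτ, x, y, hs, hx, hy, hxτ, hneg, hyτ⟩ := h₁
  obtain ⟨hσ, u, v, hs', hu, hv, huσ, hneg', hvσ⟩ := h₂
  obtain ⟨rfl, rfl⟩ := hs.unique hs' (hx.trans hu.symm) (hy.trans hv.symm)
  have hτσ : τ = σ := by
    rcases lt_trichotomy τ σ with h | h | h
    · exact absurd hxτ (hneg' τ ⟨hτ, h⟩).ne
    · exact h
    · exact absurd huσ (hneg σ ⟨hσ, h⟩).ne
  subst hτσ
  exact ⟨rfl, hyτ.symm.trans hvσ⟩

/-- The set of definition `I ⊆ [0, ∞)` of the left Poincaré half-map: all `y₀ ≥ 0` whose orbit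
returns to the section through `x < 0`, and also the origin, when arbitrarily small `u > 0` are
sent to arbitrarily small `v < 0`, so that the map extends continuously by the value `0`. -/
def leftHalfMapDomain (T D a : ℝ) : Set ℝ :=
  {y₀ | 0 ≤ y₀ ∧ ((∃ y₁ τ, IsLeftReturn T D a y₀ τ y₁) ∨
    (y₀ = 0 ∧ ∀ ε > 0, ∃ u ∈ Ioo 0 ε, ∃ v ∈ Ioo (-ε) 0, ∃ τ, IsLeftReturn T D a u τ v))}

open Classical in
/-- The left Poincaré half-map `P`, meaningful on `leftHalfMapDomain T D a`: the (unique) point of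
return if there is one, and otherwise `0`, the value of the continuous extension to the origin. -/
noncomputable def leftHalfMap (T D a y₀ : ℝ) : ℝ :=
  if h : ∃ y₁ τ, IsLeftReturn T D a y₀ τ y₁ then h.choose else 0

/-- The quadratic polynomial `W(y) = D y² - a T y + a²`. -/
def polyW (T D a y : ℝ) : ℝ := D * y ^ 2 - a * T * y + a ^ 2

/-- The sixth-order polynomial in `y₀` of the expansion at the origin, where `y₁ = P(0)`. -/
noncomputable def taylorPoly (T D a y₁ y₀ : ℝ) : ℝ :=
  y₁ + polyW T D a y₁ * y₀ ^ 2 / (2 * a ^ 2 * y₁)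
    + T * polyW T D a y₁ * y₀ ^ 3 / (3 * a ^ 3 * y₁)
    - (a ^ 2 + (D - 2 * T ^ 2) * y₁ ^ 2) * polyW T D a y₁ * y₀ ^ 4 / (8 * a ^ 4 * y₁ ^ 3)
    - T * (5 * a ^ 2 + (7 * D - 6 * T ^ 2) * y₁ ^ 2) * polyW T D a y₁ * y₀ ^ 5
        / (30 * a ^ 5 * y₁ ^ 3)
    + (9 * a ^ 4 - 6 * a ^ 3 * T * y₁ + 2 * a ^ 2 * (9 * D - 13 * T ^ 2) * y₁ ^ 2
        + (9 * D ^ 2 - 46 * D * T ^ 2 + 24 * T ^ 4) * y₁ ^ 4) * polyW T D a y₁ * y₀ ^ 6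
        / (144 * a ^ 6 * y₁ ^ 5)

/-! The half-map is parametrized by its flight time. If the eigenvalues are real, `x'` has constant
sign along the orbit of the origin for `t > 0`, so that orbit cannot return; hence `D = T² / 4 + b²`
with `b > 0`. Then `x(t) = A(t) - y₀ B(t)`, where `B` is `impulse`, `A` is `originOrbit` and `A' = a
B`. An orbit on the section at time `t` thus starts at `f = A / B` (`startOf`) and lands at `g = f
B' - a B` (`returnOf`), so `P (f t) = g t`.

The return of the origin forces `a < 0`, `T > 0` and a flight time `τ` between `π / b` and `2π / b`.
There `B < 0` and `g < 0`, so `f' = -g / B < 0`, and `f` maps `(π / b, τ]` onto `[0, ∞)`. Inverting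
`f` makes `P` analytic, also across `0`, since `f` continues past `τ`.

Since `g' = -f exp (T t) / B` and `W(g) = exp (T t) W(f)`, the extended `P` solves `P' P W(y) = y
W(P)`. This equation is regular at `0` because `P(0) W(0) = y₁ a² ≠ 0`, so an approximate solution
with residual `O(y ^ 6)` and the same initial value agrees with `P` up to `O(y ^ 7)`. -/

/-! ### Taylor expansion from the differential equation -/

/-- A function vanishing at the origin whose derivative is `O(y ^ k)` is itself `O(y ^ (k + 1))`. -/
lemma isBigO_pow_succ_of_hasDerivAt {E E' : ℝ → ℝ} {k : ℕ}
    (h : ∀ᶠ y in 𝓝 (0 : ℝ), HasDerivAt E (E' y) y) (h0 : E 0 = 0)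
    (hE' : E' =O[𝓝 0] fun y : ℝ => y ^ k) : E =O[𝓝 0] fun y : ℝ => y ^ (k + 1) := by
  obtain ⟨C, hC0, hC⟩ := hE'.exists_pos
  obtain ⟨r, hr, hball⟩ := Metric.eventually_nhds_iff_ball.1 (h.and hC.bound)
  refine IsBigO.of_bound C (Metric.eventually_nhds_iff_ball.2 ⟨r, hr, fun y hy => ?_⟩)
  rw [Metric.mem_ball, dist_zero_right] at hy
  have hsub : ∀ z ∈ Metric.closedBall (0 : ℝ) ‖y‖, z ∈ Metric.ball (0 : ℝ) r := fun z hz =>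
    Metric.closedBall_subset_ball hy hz
  have hC1 : ∀ z ∈ Metric.closedBall (0 : ℝ) ‖y‖, ‖E' z‖ ≤ C * ‖y‖ ^ k := by
    intro z hz
    refine (hball z (hsub z hz)).2.trans ?_
    rw [norm_pow]
    rw [Metric.mem_closedBall, dist_zero_right] at hz
    gcongr
  have := (convex_closedBall (0 : ℝ) ‖y‖).norm_image_sub_le_of_norm_hasDerivWithin_le
    (fun z hz => (hball z (hsub z hz)).1.hasDerivWithinAt) hC1
    (Metric.mem_closedBall_self (norm_nonneg y)) (by simp : y ∈ Metric.closedBall (0 : ℝ) ‖y‖)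
  rwa [h0, sub_zero, sub_zero, mul_assoc, ← pow_succ, ← norm_pow] at this

/-- The sextic truncation of a power series solution of `P' P W(y) = y W(P)`, where
`W(y) = D y² + w y + v`, solves the equation up to `O(y ^ 6)`. -/
lemma sextic_residual {D w v p c₂ c₃ c₄ c₅ c₆ : ℝ}
    (h₁ : 2 * c₂ * p * v = D * p ^ 2 + p * w + v)
    (h₂ : 2 * c₂ * p * w + 3 * c₃ * p * v = 0)
    (h₃ : 2 * c₂ * c₂ * v + 3 * c₃ * p * w + 4 * c₄ * p * v - c₂ * w = 0)
    (h₄ : 2 * c₂ * c₂ * w + 5 * c₂ * c₃ * v + D * c₃ * p + 4 * c₄ * p * w + 5 * c₅ * p * v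
      - c₃ * w = 0)
    (h₅ : D * c₂ * c₂ + 5 * c₂ * c₃ * w + 6 * c₂ * c₄ * v + 3 * c₃ * c₃ * v + 2 * D * c₄ * p
      + 5 * c₅ * p * w + 6 * c₆ * p * v - c₄ * w = 0) :
    ∃ S : ℝ → ℝ, Continuous S ∧ ∀ y : ℝ,
      (2 * c₂ * y + 3 * c₃ * y ^ 2 + 4 * c₄ * y ^ 3 + 5 * c₅ * y ^ 4 + 6 * c₆ * y ^ 5) *
        (p + c₂ * y ^ 2 + c₃ * y ^ 3 + c₄ * y ^ 4 + c₅ * y ^ 5 + c₆ * y ^ 6) *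
        (D * y ^ 2 + w * y + v) -
      y * (D * (p + c₂ * y ^ 2 + c₃ * y ^ 3 + c₄ * y ^ 4 + c₅ * y ^ 5 + c₆ * y ^ 6) ^ 2 +
        w * (p + c₂ * y ^ 2 + c₃ * y ^ 3 + c₄ * y ^ 4 + c₅ * y ^ 5 + c₆ * y ^ 6) + v) =
      y ^ 6 * S y := by
  -- The hypotheses annihilate the coefficients of `y, …, y ^ 5`; `S` collects those of `y ^ 6, …, y
  -- ^ 13`.
  refine ⟨fun y => (3 * D * c₂ * c₃ + 6 * c₂ * c₄ * w + 7 * c₂ * c₅ * v + 3 * c₃ * c₃ * w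
      + 7 * c₃ * c₄ * v + 3 * D * c₅ * p + 6 * c₆ * p * w - c₅ * w)
    + (4 * D * c₂ * c₄ + 7 * c₂ * c₅ * w + 8 * c₂ * c₆ * v + 2 * D * c₃ * c₃ + 7 * c₃ * c₄ * w
      + 8 * c₃ * c₅ * v + 4 * c₄ * c₄ * v + 4 * D * c₆ * p - c₆ * w) * y
    + (5 * D * c₂ * c₅ + 8 * c₂ * c₆ * w + 5 * D * c₃ * c₄ + 8 * c₃ * c₅ * w + 9 * c₃ * c₆ * v
      + 4 * c₄ * c₄ * w + 9 * c₄ * c₅ * v) * y ^ 2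
    + (6 * D * c₂ * c₆ + 6 * D * c₃ * c₅ + 9 * c₃ * c₆ * w + 3 * D * c₄ * c₄ + 9 * c₄ * c₅ * w
      + 10 * c₄ * c₆ * v + 5 * c₅ * c₅ * v) * y ^ 3
    + (7 * D * c₃ * c₆ + 7 * D * c₄ * c₅ + 10 * c₄ * c₆ * w + 5 * c₅ * c₅ * w
      + 11 * c₅ * c₆ * v) * y ^ 4
    + (8 * D * c₄ * c₆ + 4 * D * c₅ * c₅ + 11 * c₅ * c₆ * w + 6 * c₆ * c₆ * v) * y ^ 5
    + (9 * D * c₅ * c₆ + 6 * c₆ * c₆ * w) * y ^ 6 + (5 * D * c₆ * c₆) * y ^ 7,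
    by fun_prop, fun y => ?_⟩
  linear_combination y * h₁ + y ^ 2 * h₂ + y ^ 3 * h₃ + y ^ 4 * h₄ + y ^ 5 * h₅

/-- `taylorPoly` solves the differential equation of the half-map up to `O(y ^ 6)`. -/
lemma taylorPoly_residual (T D : ℝ) {a y₁ : ℝ} (ha : a ≠ 0) (hy₁ : y₁ ≠ 0) :
    ∃ Q' S : ℝ → ℝ, Continuous Q' ∧ Continuous S ∧
      (∀ y, HasDerivAt (taylorPoly T D a y₁) (Q' y) y) ∧
      ∀ y, Q' y * taylorPoly T D a y₁ y * polyW T D a y - y * polyW T D a (taylorPoly T D a y₁ y) =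
        y ^ 6 * S y := by
  obtain ⟨c₂, hc₂⟩ : ∃ c, c = polyW T D a y₁ / (2 * a ^ 2 * y₁) := ⟨_, rfl⟩
  obtain ⟨c₃, hc₃⟩ : ∃ c, c = T * polyW T D a y₁ / (3 * a ^ 3 * y₁) := ⟨_, rfl⟩
  obtain ⟨c₄, hc₄⟩ : ∃ c, c = -((a ^ 2 + (D - 2 * T ^ 2) * y₁ ^ 2) * polyW T D a y₁ /
    (8 * a ^ 4 * y₁ ^ 3)) := ⟨_, rfl⟩
  obtain ⟨c₅, hc₅⟩ : ∃ c, c = -(T * (5 * a ^ 2 + (7 * D - 6 * T ^ 2) * y₁ ^ 2) * polyW T D a y₁ /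
    (30 * a ^ 5 * y₁ ^ 3)) := ⟨_, rfl⟩
  obtain ⟨c₆, hc₆⟩ : ∃ c, c = (9 * a ^ 4 - 6 * a ^ 3 * T * y₁ +
    2 * a ^ 2 * (9 * D - 13 * T ^ 2) * y₁ ^ 2 + (9 * D ^ 2 - 46 * D * T ^ 2 + 24 * T ^ 4) * y₁ ^ 4) *
    polyW T D a y₁ / (144 * a ^ 6 * y₁ ^ 5) := ⟨_, rfl⟩
  have hQ : taylorPoly T D a y₁ = fun y => y₁ + c₂ * y ^ 2 + c₃ * y ^ 3 + c₄ * y ^ 4 + c₅ * y ^ 5 +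
      c₆ * y ^ 6 := by
    funext y
    rw [hc₂, hc₃, hc₄, hc₅, hc₆, taylorPoly]
    ring
  obtain ⟨S, hS, hres⟩ := sextic_residual (D := D) (w := -a * T) (v := a ^ 2) (p := y₁) (c₂ := c₂)
    (c₃ := c₃) (c₄ := c₄) (c₅ := c₅) (c₆ := c₆)
    (by rw [hc₂, polyW]; field_simp; ring)
    (by rw [hc₂, hc₃, polyW]; field_simp; ring)
    (by rw [hc₂, hc₃, hc₄, polyW]; field_simp; ring)
    (by rw [hc₂, hc₃, hc₄, hc₅, polyW]; field_simp; ring)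
    (by rw [hc₂, hc₃, hc₄, hc₅, hc₆, polyW]; field_simp; ring)
  refine ⟨fun y => 2 * c₂ * y + 3 * c₃ * y ^ 2 + 4 * c₄ * y ^ 3 + 5 * c₅ * y ^ 4 + 6 * c₆ * y ^ 5, S,
    by fun_prop, hS, fun y => ?_, fun y => ?_⟩
  · rw [hQ]
    have h := ((((((hasDerivAt_pow 2 y).const_mul c₂).const_add y₁).add
      ((hasDerivAt_pow 3 y).const_mul c₃)).add ((hasDerivAt_pow 4 y).const_mul c₄)).add
      ((hasDerivAt_pow 5 y).const_mul c₅)).add ((hasDerivAt_pow 6 y).const_mul c₆)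
    refine h.congr_deriv ?_
    push_cast
    ring
  · rw [← hres y, hQ]
    simp only [polyW]
    ring

/-- A solution of `P' P W(y) = y W(P)` has the expansion `taylorPoly` at the origin. -/
lemma sub_taylorPoly_isBigO {T D a y₁ : ℝ} {P P' : ℝ → ℝ} (ha : a ≠ 0) (hy₁ : y₁ ≠ 0)
    (hP0 : P 0 = y₁) (hP : ∀ᶠ y in 𝓝 (0 : ℝ), HasDerivAt P (P' y) y)
    (hode : ∀ᶠ y in 𝓝 (0 : ℝ), P' y * P y * polyW T D a y = y * polyW T D a (P y)) :
    (fun y => P y - taylorPoly T D a y₁ y) =O[𝓝 0] fun y : ℝ => y ^ 7 := by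
  obtain ⟨Q', S, hQ', hS, hQ, hres⟩ := taylorPoly_residual T D ha hy₁
  set Q := taylorPoly T D a y₁ with hQdef
  have hQc : Continuous Q := continuous_iff_continuousAt.2 fun y => (hQ y).continuousAt
  have hPc : ContinuousAt P 0 := hP.self_of_nhds.continuousAt
  have hWc : Continuous (polyW T D a) := by unfold polyW; fun_prop
  have hPW : ContinuousAt (fun y => P y * polyW T D a y) 0 := hPc.mul hWc.continuousAt
  have hPW0 : P 0 * polyW T D a 0 ≠ 0 := by
    rw [hP0]
    simpa [polyW] using ⟨hy₁, ha⟩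
  -- Since `W(P) - W(Q) = (P - Q) (D (P + Q) - a T)`, subtracting the two equations gives the linear
  -- equation `E' = h E - y ^ 6 k` for `E = P - Q`.
  let h : ℝ → ℝ := fun y => (P y * polyW T D a y)⁻¹ *
    (y * (D * (P y + Q y) - a * T) - polyW T D a y * Q' y)
  let k : ℝ → ℝ := fun y => (P y * polyW T D a y)⁻¹ * S y
  have hh : ContinuousAt h 0 := by
    have := hPW.inv₀ hPW0
    fun_prop
  have hk : ContinuousAt k 0 := (hPW.inv₀ hPW0).mul hS.continuousAt
  have hE : ∀ᶠ y in 𝓝 (0 : ℝ), HasDerivAt (fun y => P y - Q y) (P' y - Q' y) y := by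
    filter_upwards [hP] with y hy using hy.sub (hQ y)
  have hE' : (fun y => P' y - Q' y) =ᶠ[𝓝 0] fun y => (P y - Q y) * h y - y ^ 6 * k y := by
    filter_upwards [hode, hPW.eventually_ne hPW0] with y hy hne
    simp only [h, k]
    rw [mul_left_comm, mul_left_comm (y ^ 6), ← mul_sub, eq_inv_mul_iff_mul_eq₀ hne, ← hres y]
    simp only [polyW] at hy ⊢
    linear_combination hy
  -- Bootstrap: `E = O(y ^ n)` with `n ≤ 6` gives `E' = O(y ^ n)`, and integration gains one order;
  -- the residual stops this at `7`.
  have step : ∀ n ≤ 7, (fun y => P y - Q y) =O[𝓝 0] fun y : ℝ => y ^ n := by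
    intro n
    induction n with
    | zero =>
      intro _
      simpa using (hPc.sub hQc.continuousAt).isBigO_one ℝ
    | succ n ih =>
      intro hn
      refine isBigO_pow_succ_of_hasDerivAt hE ?_ ?_
      · rw [hP0, hQdef]
        simp [taylorPoly]
      · refine hE'.trans_isBigO (IsBigO.sub ?_ ?_)
        · simpa using (ih (by omega)).mul (hh.isBigO_one ℝ)
        · have h6 : (fun y : ℝ => y ^ 6) =O[𝓝 0] fun y : ℝ => y ^ n :=
            ((isBigO_refl (fun y : ℝ => y ^ n) _).mul ((continuous_pow (6 - n)).continuousAt.isBigO_one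
              ℝ)).congr (fun y => by rw [← pow_add]; congr 1; omega) fun y => mul_one _
          simpa using h6.mul (hk.isBigO_one ℝ)
  exact step 7 le_rfl

/-! ### Real eigenvalues: the origin does not return -/

section RealSpectrum

/-- If the system has real eigenvalues, the orbit of the origin does not return to the section. -/
lemma not_isLeftReturn_zero_of_sq_ge {T D a τ y₁ : ℝ} (hTD : 4 * D ≤ T ^ 2) :
    ¬ IsLeftReturn T D a 0 τ y₁ := by
  rintro ⟨hτ, x, y, hs, hx0, hy0, hxτ, hneg, -⟩
  obtain ⟨s, hs2⟩ : ∃ s : ℝ, s ^ 2 = T ^ 2 - 4 * D :=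
    ⟨√(T ^ 2 - 4 * D), Real.sq_sqrt (by linarith)⟩
  obtain ⟨l, m, hsum, hprod⟩ : ∃ l m : ℝ, l + m = T ∧ l * m = D :=
    ⟨(T + s) / 2, (T - s) / 2, by ring, by linear_combination (-1 / 4) * hs2⟩
  have hexp : ∀ c t : ℝ, HasDerivAt (fun t => Real.exp (c * t)) (Real.exp (c * t) * c) t :=
    fun c t => by simpa using ((hasDerivAt_id t).const_mul c).exp
  have hv : ∀ t, HasDerivAt (fun t => T * x t - y t)
      (T * (T * x t - y t) - (D * x t - a)) t := fun t =>
    ((hs t).1.const_mul T).sub (hs t).2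
  -- the solution `v' - l v` of the first factor of the variational equation
  have hu : ∀ t, T * (T * x t - y t) - (D * x t - a) - l * (T * x t - y t) =
      a * Real.exp (m * t) := by
    have hd : ∀ t, HasDerivAt (fun t => (T * (T * x t - y t) - (D * x t - a) -
        l * (T * x t - y t)) * Real.exp (-m * t)) 0 t := fun t => by
      refine (((((hv t).const_mul T).sub (((hs t).1.const_mul D).sub_const a)).sub
        ((hv t).const_mul l)).mul (hexp (-m) t)).congr_deriv ?_
      rw [← hsum, ← hprod]
      simp only [Pi.sub_apply]
      ring
    intro t
    have := is_const_of_deriv_eq_zero (fun t => (hd t).differentiableAt) (fun t => (hd t).deriv) t 0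
    simp only [hx0, hy0, mul_zero, sub_zero, zero_sub, sub_neg_eq_add, zero_add, Real.exp_zero,
      mul_one] at this
    conv_rhs => rw [← this, mul_assoc, ← Real.exp_add, neg_mul, neg_add_cancel, Real.exp_zero, mul_one]
  -- With the integrating factor `exp (-l t)`, the derivative has the sign of `a`. As `x'` vanishes
  -- at `0`, this fixes its sign for `t > 0`: `x` is nondecreasing if `a ≥ 0` and strictly
  -- decreasing if `a < 0`.
  have hw : ∀ t, HasDerivAt (fun t => (T * x t - y t) * Real.exp (-l * t))
      (a * (Real.exp (m * t) * Real.exp (-l * t))) t := fun t => by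
    refine ((hv t).mul (hexp (-l) t)).congr_deriv ?_
    linear_combination Real.exp (-l * t) * hu t
  have hwc : Continuous fun t => (T * x t - y t) * Real.exp (-l * t) :=
    continuous_iff_continuousAt.2 fun t => (hw t).continuousAt
  have hxc : Continuous x := continuous_iff_continuousAt.2 fun t => (hs t).1.continuousAt
  rcases le_or_gt 0 a with ha | ha
  · have hmono : Monotone fun t => (T * x t - y t) * Real.exp (-l * t) :=
      monotone_of_hasDerivAt_nonneg hw fun t => by simp only [Pi.zero_apply]; positivity
    have hv0 : ∀ t, 0 ≤ t → 0 ≤ T * x t - y t := fun t ht => by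
      have := hmono ht
      simp only [hx0, hy0, mul_zero, sub_zero, zero_mul] at this
      exact nonneg_of_mul_nonneg_left this (Real.exp_pos _)
    have hxm : MonotoneOn x (Ici 0) := monotoneOn_of_hasDerivWithinAt_nonneg (convex_Ici 0)
      hxc.continuousOn (fun t _ => (hs t).1.hasDerivWithinAt) fun t ht => by
        rw [interior_Ici] at ht
        exact hv0 t (le_of_lt ht)
    have := hxm (mem_Ici.2 le_rfl) (mem_Ici.2 (half_pos hτ).le) (half_pos hτ).le
    have := hneg (τ / 2) ⟨half_pos hτ, half_lt_self hτ⟩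
    linarith
  · have hanti : StrictAnti fun t => (T * x t - y t) * Real.exp (-l * t) :=
      strictAnti_of_hasDerivAt_neg hw fun t => mul_neg_of_neg_of_pos ha (by positivity)
    have hv0 : ∀ t, 0 < t → T * x t - y t < 0 := fun t ht => by
      have := hanti ht
      simp only [hx0, hy0, mul_zero, sub_zero, zero_mul] at this
      exact neg_of_mul_neg_left this (Real.exp_pos _).le
    have hxm : StrictAntiOn x (Ici 0) := strictAntiOn_of_hasDerivWithinAt_neg (convex_Ici 0)
      hxc.continuousOn (fun t _ => (hs t).1.hasDerivWithinAt) fun t ht => by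
        rw [interior_Ici] at ht
        exact hv0 t ht
    have := hxm (mem_Ici.2 le_rfl) (mem_Ici.2 hτ.le) hτ
    linarith

end RealSpectrum

/-! ### Complex eigenvalues: explicit orbits and the return of the origin -/

section ComplexSpectrum

/-- The solution of `B'' - T B' + (T² / 4 + b²) B = 0` with `B(0) = 0`, `B'(0) = 1`. -/
noncomputable def impulse (T b t : ℝ) : ℝ := Real.exp (T / 2 * t) * (Real.sin (b * t) / b)

/-- The derivative of `impulse`. -/
noncomputable def impulseDeriv (T b t : ℝ) : ℝ :=
  Real.exp (T / 2 * t) * (Real.cos (b * t) + T / (2 * b) * Real.sin (b * t))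

/-- The first coordinate of the orbit of the origin. -/
noncomputable def originOrbit (T D a b t : ℝ) : ℝ :=
  a / D * (1 - impulseDeriv T b t + T * impulse T b t)

/-- The point of the section whose orbit is on the section again at the time `t`. -/
noncomputable def startOf (T D a b t : ℝ) : ℝ := originOrbit T D a b t / impulse T b t

/-- The point where the orbit of `startOf T D a b t` meets the section at the time `t`. -/
noncomputable def returnOf (T D a b t : ℝ) : ℝ :=
  startOf T D a b t * impulseDeriv T b t - a * impulse T b t

variable {T D a b t : ℝ}

lemma hasDerivAt_impulse (T t : ℝ) (hb : b ≠ 0) :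
    HasDerivAt (impulse T b) (impulseDeriv T b t) t := by
  have he : HasDerivAt (fun t => Real.exp (T / 2 * t)) (Real.exp (T / 2 * t) * (T / 2)) t := by
    simpa using ((hasDerivAt_id t).const_mul (T / 2)).exp
  have hs : HasDerivAt (fun t => Real.sin (b * t)) (Real.cos (b * t) * b) t := by
    simpa using ((hasDerivAt_id t).const_mul b).sin
  refine (he.mul (hs.div_const b)).congr_deriv ?_
  rw [impulseDeriv]
  field_simp
  ring

lemma hasDerivAt_impulseDeriv (t : ℝ) (hb : b ≠ 0) (hD : D = T ^ 2 / 4 + b ^ 2) :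
    HasDerivAt (impulseDeriv T b) (T * impulseDeriv T b t - D * impulse T b t) t := by
  have he : HasDerivAt (fun t => Real.exp (T / 2 * t)) (Real.exp (T / 2 * t) * (T / 2)) t := by
    simpa using ((hasDerivAt_id t).const_mul (T / 2)).exp
  have hs : HasDerivAt (fun t => Real.sin (b * t)) (Real.cos (b * t) * b) t := by
    simpa using ((hasDerivAt_id t).const_mul b).sin
  have hc : HasDerivAt (fun t => Real.cos (b * t)) (-Real.sin (b * t) * b) t := by
    simpa using ((hasDerivAt_id t).const_mul b).cos
  refine (he.mul (hc.add (hs.const_mul (T / (2 * b))))).congr_deriv ?_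
  rw [impulseDeriv, impulse, hD]
  simp only [Pi.add_apply]
  field_simp
  ring

/-- Liouville's formula: the left side is the Wronskian `B' ^ 2 - B B''`, and the system has trace
`T`. -/
lemma impulse_energy (t : ℝ) (hb : b ≠ 0) (hD : D = T ^ 2 / 4 + b ^ 2) :
    impulseDeriv T b t ^ 2 - T * impulse T b t * impulseDeriv T b t + D * impulse T b t ^ 2 =
      Real.exp (T * t) := by
  have he : Real.exp (T * t) = Real.exp (T / 2 * t) ^ 2 := by
    rw [← Real.exp_nat_mul]
    congr 1
    push_cast
    ring
  rw [he, impulseDeriv, impulse, hD]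
  have := Real.sin_sq_add_cos_sq (t * b)
  field_simp
  linear_combination 16 * b ^ 2 * this

/-- `1 - B' + T B` has derivative `D B`, so `originOrbit` is `a` times the primitive of `B` that
vanishes at `0`. -/
lemma hasDerivAt_originOrbit (a t : ℝ) (hb : b ≠ 0) (hD : D = T ^ 2 / 4 + b ^ 2) :
    HasDerivAt (originOrbit T D a b) (a * impulse T b t) t := by
  have hD0 : D ≠ 0 := by rw [hD]; positivity
  refine ((((hasDerivAt_impulseDeriv t hb hD).const_sub 1).add
    ((hasDerivAt_impulse T t hb).const_mul T)).const_mul (a / D)).congr_deriv ?_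
  field_simp
  ring

lemma isLienardSolution_impulse (a y₀ : ℝ) (hb : b ≠ 0) (hD : D = T ^ 2 / 4 + b ^ 2) :
    IsLienardSolution T D a (fun t => originOrbit T D a b t - y₀ * impulse T b t)
      (fun t => T * (originOrbit T D a b t - y₀ * impulse T b t) -
        (a * impulse T b t - y₀ * impulseDeriv T b t)) := by
  intro t
  have hD0 : D ≠ 0 := by rw [hD]; positivity
  have hx := (hasDerivAt_originOrbit a t hb hD).sub ((hasDerivAt_impulse T t hb).const_mul y₀)
  refine ⟨hx.congr_deriv (by ring), ((hx.const_mul T).sub (((hasDerivAt_impulse T t hb).const_mul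
    a).sub ((hasDerivAt_impulseDeriv t hb hD).const_mul y₀))).congr_deriv ?_⟩
  simp only [originOrbit]
  field_simp
  ring

lemma originOrbit_zero (T D a b : ℝ) : originOrbit T D a b 0 = 0 := by
  simp [originOrbit, impulse, impulseDeriv]

lemma impulse_zero (T b : ℝ) : impulse T b 0 = 0 := by simp [impulse]

lemma impulseDeriv_zero (T b : ℝ) : impulseDeriv T b 0 = 1 := by simp [impulseDeriv]

lemma isLeftReturn_of_originOrbit {y₀ : ℝ} (hb : b ≠ 0) (hD : D = T ^ 2 / 4 + b ^ 2) (ht : 0 < t)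
    (hx : originOrbit T D a b t = y₀ * impulse T b t)
    (hneg : ∀ s ∈ Ioo 0 t, originOrbit T D a b s < y₀ * impulse T b s) :
    IsLeftReturn T D a y₀ t (y₀ * impulseDeriv T b t - a * impulse T b t) := by
  refine ⟨ht, _, _, isLienardSolution_impulse a y₀ hb hD, ?_, ?_, ?_, fun s hs => ?_, ?_⟩
  · simp [originOrbit_zero, impulse_zero]
  · simp [originOrbit_zero, impulse_zero, impulseDeriv_zero]
  · exact sub_eq_zero.2 hx
  · exact sub_neg.2 (hneg s hs)
  · rw [hx]
    ring

lemma impulse_pos (T : ℝ) (hb : 0 < b) (ht : t ∈ Ioo 0 (Real.pi / b)) : 0 < impulse T b t := by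
  have h1 : b * t < Real.pi := by rw [mul_comm]; exact (lt_div_iff₀ hb).1 ht.2
  have := Real.sin_pos_of_pos_of_lt_pi (mul_pos hb ht.1) h1
  unfold impulse
  positivity

lemma impulse_neg (T : ℝ) (hb : 0 < b) (ht : t ∈ Ioo (Real.pi / b) (2 * Real.pi / b)) :
    impulse T b t < 0 := by
  have h1 : Real.pi < b * t := by rw [mul_comm]; exact (div_lt_iff₀ hb).1 ht.1
  have h2 : b * t < 2 * Real.pi := by rw [mul_comm]; exact (lt_div_iff₀ hb).1 ht.2
  have := Real.sin_pos_of_pos_of_lt_pi (x := b * t - Real.pi) (by linarith) (by linarith)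
  rw [Real.sin_sub_pi] at this
  exact mul_neg_of_pos_of_neg (Real.exp_pos _) (div_neg_of_neg_of_pos (by linarith) hb)

lemma impulse_pi_div (T : ℝ) (hb : b ≠ 0) : impulse T b (Real.pi / b) = 0 := by
  rw [impulse, mul_div_cancel₀ _ hb]
  simp

/-- Decides the sign of `returnOf`. Here `sin (b t) < 0` bounds `B'` by `exp (T t / 2)`, and `exp (T
t / 2) > 1`. -/
lemma impulseDeriv_lt_exp (hT : 0 < T) (hb : 0 < b)
    (ht : t ∈ Ioo (Real.pi / b) (2 * Real.pi / b)) : impulseDeriv T b t < Real.exp (T * t) := by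
  have hs : Real.sin (b * t) < 0 := by
    have h := impulse_neg T hb ht
    have h1 := (pos_iff_neg_of_mul_neg h).1 (Real.exp_pos _)
    by_contra! h2
    exact absurd (div_nonneg h2 hb.le) (not_le.2 h1)
  have ht0 : 0 < t := lt_trans (by positivity) ht.1
  have he : Real.exp (T * t) = Real.exp (T / 2 * t) * Real.exp (T / 2 * t) := by
    rw [← Real.exp_add]
    congr 1
    ring
  have h1 : (1 : ℝ) < Real.exp (T / 2 * t) := Real.one_lt_exp_iff.2 (by positivity)
  have h2 : T / (2 * b) * Real.sin (b * t) < 0 := mul_neg_of_pos_of_neg (by positivity) hs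
  rw [he, impulseDeriv]
  gcongr
  linarith [Real.cos_le_one (b * t)]

/-- For `a > 0` the orbit of the origin would first enter `x > 0`, and conversely. -/
lemma originOrbit_div_pos (ha : a ≠ 0) (hb : 0 < b) (hD : D = T ^ 2 / 4 + b ^ 2)
    (ht : t ∈ Ioc 0 (Real.pi / b)) : 0 < originOrbit T D a b t / a := by
  have hm : StrictMonoOn (fun t => originOrbit T D a b t / a) (Icc 0 (Real.pi / b)) := by
    refine strictMonoOn_of_hasDerivWithinAt_pos (convex_Icc _ _)
      (fun t _ => ((hasDerivAt_originOrbit a t hb.ne' hD).div_const a).continuousAt.continuousWithinAt)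
      (fun t _ => ((hasDerivAt_originOrbit a t hb.ne' hD).div_const a).hasDerivWithinAt)
      fun t ht => ?_
    rw [interior_Icc] at ht
    rw [mul_div_cancel_left₀ _ ha]
    exact impulse_pos T hb ht
  simpa [originOrbit_zero] using hm (left_mem_Icc.2 (ht.1.trans_le ht.2).le) ⟨ht.1.le, ht.2⟩ ht.1

lemma originOrbit_neg (ha : a < 0) (hb : 0 < b) (hD : D = T ^ 2 / 4 + b ^ 2)
    (ht : t ∈ Ioc 0 (Real.pi / b)) : originOrbit T D a b t < 0 := by
  by_contra! h
  exact absurd (originOrbit_div_pos ha.ne hb hD ht)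
    (not_lt.2 (div_nonpos_of_nonneg_of_nonpos h ha.le))

lemma originOrbit_eq (T D a b t : ℝ) : originOrbit T D a b t =
    a / D * (1 - Real.exp (T / 2 * t) * (Real.cos (b * t) - T / (2 * b) * Real.sin (b * t))) := by
  rw [originOrbit, impulseDeriv, impulse]
  ring

/-- If the orbit of the origin returns to the section below the origin, then `a < 0`, `T > 0` and
the return takes between one half turn and one turn. -/
lemma parameters_of_isLeftReturn_zero {τ y₁ : ℝ} (hb : 0 < b) (hD : D = T ^ 2 / 4 + b ^ 2)
    (h : IsLeftReturn T D a 0 τ y₁) (hy₁ : y₁ < 0) :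
    a < 0 ∧ 0 < T ∧ τ ∈ Ioo (Real.pi / b) (2 * Real.pi / b) ∧ originOrbit T D a b τ = 0 := by
  have hD0 : 0 < D := by rw [hD]; positivity
  obtain ⟨hτ, x, y, hs, hx0, hy0, hxτ, hneg, hyτ⟩ := h
  obtain ⟨rfl, rfl⟩ := hs.unique (isLienardSolution_impulse a 0 hb.ne' hD)
    (by simpa [originOrbit_zero]) (by simpa [originOrbit_zero, impulse_zero])
  simp only [zero_mul, sub_zero] at hxτ hneg hyτ
  rw [hxτ] at hyτ
  have hpi : 0 < Real.pi / b := by positivity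
  have ha : a < 0 := by
    -- A time both during the flight and within the first half turn, where `originOrbit / a` is
    -- positive.
    have ht : 0 < min (τ / 2) (Real.pi / b) := lt_min (half_pos hτ) hpi
    have h1 := hneg _ ⟨ht, (min_le_left _ _).trans_lt (half_lt_self hτ)⟩
    rcases eq_or_ne a 0 with rfl | ha
    · simp [originOrbit] at h1
    · have h2 := originOrbit_div_pos ha hb hD ⟨ht, min_le_right _ _⟩
      by_contra! h3
      exact absurd h2 (not_lt.2 (div_nonpos_of_nonpos_of_nonneg h1.le h3))
  have haD : a / D < 0 := div_neg_of_neg_of_pos ha hD0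
  -- The return condition reads `cos (b τ) - T / (2 b) sin (b τ) = exp (-T τ / 2)`. For `T < 0` the
  -- left side is at most `1 - T τ / 2`, which is too small; for `T = 0` the orbit closes up at the
  -- origin, against `y₁ < 0`.
  have hT : 0 < T := by
    by_contra! hT
    have hone : Real.exp (T / 2 * τ) * (Real.cos (b * τ) - T / (2 * b) * Real.sin (b * τ)) = 1 := by
      rw [originOrbit_eq] at hxτ
      linarith [(mul_eq_zero.1 hxτ).resolve_left haD.ne]
    rcases hT.lt_or_eq with hT | rfl
    · have h1 : -(T / 2 * τ) + 1 < Real.exp (-(T / 2 * τ)) :=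
        Real.add_one_lt_exp (neg_ne_zero.2 (mul_ne_zero (by linarith) hτ.ne'))
      have h2 : Real.cos (b * τ) - T / (2 * b) * Real.sin (b * τ) = Real.exp (-(T / 2 * τ)) := by
        rw [Real.exp_neg]
        exact eq_inv_of_mul_eq_one_right hone
      have h3 : -(T / (2 * b)) * Real.sin (b * τ) ≤ -(T / (2 * b)) * (b * τ) :=
        mul_le_mul_of_nonneg_left (Real.sin_le (by positivity))
          (neg_nonneg.2 (div_nonpos_of_nonpos_of_nonneg hT.le (by positivity)))
      have h4 : -(T / (2 * b)) * (b * τ) = -(T / 2 * τ) := by field_simp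
      linarith [Real.cos_le_one (b * τ)]
    · have hcos : Real.cos (b * τ) = 1 := by simpa using hone
      have hsin : Real.sin (b * τ) = 0 := by
        have := Real.sin_sq_add_cos_sq (b * τ)
        rw [hcos] at this
        exact pow_eq_zero_iff (two_ne_zero) |>.1 (by linarith)
      rw [impulse, hsin] at hyτ
      simp at hyτ
      linarith
  refine ⟨ha, hT, ⟨?_, ?_⟩, hxτ⟩
  · by_contra! h1
    exact (originOrbit_neg ha hb hD ⟨hτ, h1⟩).ne hxτ
  · by_contra! h1
    -- After a full turn `x = a / D (1 - exp (π T / b)) > 0`, so the flight has already ended.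
    have h2 : originOrbit T D a b (2 * Real.pi / b) ≤ 0 := by
      rcases h1.lt_or_eq with h1 | h1
      · exact (hneg _ ⟨by positivity, h1⟩).le
      · rw [h1, hxτ]
    have h3 : (1 : ℝ) < Real.exp (T / 2 * (2 * Real.pi / b)) :=
      Real.one_lt_exp_iff.2 (by positivity)
    rw [originOrbit_eq, mul_div_cancel₀ _ hb.ne', Real.cos_two_pi, Real.sin_two_pi] at h2
    nlinarith

end ComplexSpectrum

/-! ### The half-map parametrized by the flight time -/

section HalfMap

variable {T D a b t : ℝ}

lemma startOf_mul_impulse (hB : impulse T b t ≠ 0) :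
    startOf T D a b t * impulse T b t = originOrbit T D a b t := div_mul_cancel₀ _ hB

lemma startOf_relation (hD : D ≠ 0) (hB : impulse T b t ≠ 0) :
    D * (startOf T D a b t * impulse T b t) =
      a * (1 - impulseDeriv T b t + T * impulse T b t) := by
  rw [startOf_mul_impulse hB, originOrbit]
  field_simp

lemma hasDerivAt_startOf (a : ℝ) (hb : b ≠ 0) (hD : D = T ^ 2 / 4 + b ^ 2)
    (hB : impulse T b t ≠ 0) :
    HasDerivAt (startOf T D a b) (-returnOf T D a b t / impulse T b t) t := by
  refine ((hasDerivAt_originOrbit a t hb hD).div (hasDerivAt_impulse T t hb) hB).congr_deriv ?_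
  rw [returnOf, startOf]
  field_simp
  ring

/-- Inserting `f'` and `B'' = T B' - D B` leaves `-f (B' ^ 2 - T B B' + D B ^ 2) / B`, to which
`impulse_energy` applies. -/
lemma hasDerivAt_returnOf (a : ℝ) (hb : b ≠ 0) (hD : D = T ^ 2 / 4 + b ^ 2)
    (hB : impulse T b t ≠ 0) :
    HasDerivAt (returnOf T D a b) (-startOf T D a b t * Real.exp (T * t) / impulse T b t) t := by
  refine (((hasDerivAt_startOf a hb hD hB).mul (hasDerivAt_impulseDeriv t hb hD)).sub
    ((hasDerivAt_impulse T t hb).const_mul a)).congr_deriv ?_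
  rw [← impulse_energy t hb hD, eq_div_iff hB, returnOf]
  field_simp
  ring

/-- The half-map multiplies the first integral `W` of the section by `exp (T τ)`. -/
lemma polyW_returnOf (a : ℝ) (hb : b ≠ 0) (hD : D = T ^ 2 / 4 + b ^ 2)
    (hB : impulse T b t ≠ 0) :
    polyW T D a (returnOf T D a b t) = Real.exp (T * t) * polyW T D a (startOf T D a b t) := by
  have hD0 : D ≠ 0 := by rw [hD]; positivity
  have h1 := startOf_relation (a := a) hD0 hB
  rw [← impulse_energy t hb hD, polyW, polyW, returnOf]
  set f := startOf T D a b t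
  set B := impulse T b t
  set C := impulseDeriv T b t
  linear_combination (f * (T * C - D * B) - a * (1 - C + T * B) - 2 * a * C + a * T * B) * h1

/-- Eliminating `f` gives `D B g = a (B' - exp (T t))`, a product of two negative factors, while `D
B < 0`. -/
lemma returnOf_neg (ha : a < 0) (hT : 0 < T) (hb : 0 < b)
    (hD : D = T ^ 2 / 4 + b ^ 2) (ht : t ∈ Ioo (Real.pi / b) (2 * Real.pi / b)) :
    returnOf T D a b t < 0 := by
  have hD0 : 0 < D := by rw [hD]; positivity
  have hB := impulse_neg T hb ht
  have hC := impulseDeriv_lt_exp hT hb ht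
  have h1 := startOf_relation (a := a) hD0.ne' hB.ne
  have h2 : D * impulse T b t * returnOf T D a b t =
      a * (impulseDeriv T b t - Real.exp (T * t)) := by
    rw [← impulse_energy t hb.ne' hD, returnOf]
    linear_combination impulseDeriv T b t * h1
  have h3 : 0 < D * impulse T b t * returnOf T D a b t := by
    rw [h2]
    exact mul_pos_of_neg_of_neg ha (sub_neg.2 hC)
  exact (neg_iff_neg_of_mul_pos h3).1 (mul_neg_of_pos_of_neg hD0 hB)

lemma strictAntiOn_startOf (ha : a < 0) (hT : 0 < T) (hb : 0 < b)
    (hD : D = T ^ 2 / 4 + b ^ 2) :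
    StrictAntiOn (startOf T D a b) (Ioo (Real.pi / b) (2 * Real.pi / b)) := by
  have hd : ∀ t ∈ Ioo (Real.pi / b) (2 * Real.pi / b), HasDerivAt (startOf T D a b)
      (-returnOf T D a b t / impulse T b t) t := fun t ht =>
    hasDerivAt_startOf a hb.ne' hD (impulse_neg T hb ht).ne
  refine strictAntiOn_of_hasDerivWithinAt_neg (convex_Ioo _ _)
    (fun t ht => (hd t ht).continuousAt.continuousWithinAt)
    (fun t ht => (hd t (interior_subset ht)).hasDerivWithinAt) fun t ht => ?_
  have ht' := interior_subset ht
  exact div_neg_of_pos_of_neg (neg_pos.2 (returnOf_neg ha hT hb hD ht')) (impulse_neg T hb ht')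

/-- No earlier return: up to `π / b` one has `A < 0` and `B ≥ 0`; afterwards `x(s) = (f s - f t)
B(s)` with `f s > f t` and `B(s) < 0`. -/
lemma isLeftReturn_startOf (ha : a < 0) (hT : 0 < T) (hb : 0 < b) (hD : D = T ^ 2 / 4 + b ^ 2)
    (ht : t ∈ Ioo (Real.pi / b) (2 * Real.pi / b)) (h0 : 0 ≤ startOf T D a b t) :
    IsLeftReturn T D a (startOf T D a b t) t (returnOf T D a b t) := by
  have hpi : 0 < Real.pi / b := by positivity
  refine isLeftReturn_of_originOrbit hb.ne' hD (hpi.trans ht.1)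
    (startOf_mul_impulse (impulse_neg T hb ht).ne).symm fun s hs => ?_
  rcases le_or_gt s (Real.pi / b) with h | h
  · refine (originOrbit_neg ha hb hD ⟨hs.1, h⟩).trans_le (mul_nonneg h0 ?_)
    rcases h.lt_or_eq with h | rfl
    · exact (impulse_pos T hb ⟨hs.1, h⟩).le
    · rw [impulse_pi_div T hb.ne']
  · have hs' : s ∈ Ioo (Real.pi / b) (2 * Real.pi / b) := ⟨h, hs.2.trans ht.2⟩
    rw [← startOf_mul_impulse (impulse_neg T hb hs').ne]
    exact mul_lt_mul_of_neg_right (strictAntiOn_startOf ha hT hb hD hs' ht hs.2)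
      (impulse_neg T hb hs')

lemma IsLeftReturn.leftHalfMap_eq {y₀ τ y₁ : ℝ} (h : IsLeftReturn T D a y₀ τ y₁) :
    leftHalfMap T D a y₀ = y₁ := by
  have hex : ∃ y₁ τ, IsLeftReturn T D a y₀ τ y₁ := ⟨y₁, τ, h⟩
  rw [leftHalfMap, dif_pos hex]
  obtain ⟨σ, hσ⟩ := hex.choose_spec
  exact (hσ.unique h).2

lemma leftHalfMap_startOf (ha : a < 0) (hT : 0 < T) (hb : 0 < b) (hD : D = T ^ 2 / 4 + b ^ 2)
    (ht : t ∈ Ioo (Real.pi / b) (2 * Real.pi / b)) (h0 : 0 ≤ startOf T D a b t) :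
    leftHalfMap T D a (startOf T D a b t) = returnOf T D a b t :=
  (isLeftReturn_startOf ha hT hb hD ht h0).leftHalfMap_eq

/-- Every point `y₀ ≥ 0` of the section returns, not later than the origin. -/
lemma exists_startOf_eq {τ y₀ : ℝ} (ha : a < 0) (hb : 0 < b) (hD : D = T ^ 2 / 4 + b ^ 2)
    (hτ : τ ∈ Ioo (Real.pi / b) (2 * Real.pi / b)) (hA : originOrbit T D a b τ = 0)
    (hy₀ : 0 ≤ y₀) : ∃ t ∈ Ioc (Real.pi / b) τ, startOf T D a b t = y₀ := by
  have hpi : 0 < Real.pi / b := by positivity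
  -- The intermediate value theorem is applied to `A - y₀ B`, since `f = A / B` has a pole at `π /
  -- b`.
  have hx : ContinuousOn (fun t => originOrbit T D a b t - y₀ * impulse T b t)
      (Icc (Real.pi / b) τ) := fun t _ => (((hasDerivAt_originOrbit a t hb.ne' hD).sub
    ((hasDerivAt_impulse T t hb.ne').const_mul y₀)).continuousAt).continuousWithinAt
  have h1 : originOrbit T D a b (Real.pi / b) - y₀ * impulse T b (Real.pi / b) < 0 := by
    rw [impulse_pi_div T hb.ne', mul_zero, sub_zero]
    exact originOrbit_neg ha hb hD ⟨hpi, le_rfl⟩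
  have h2 : 0 ≤ originOrbit T D a b τ - y₀ * impulse T b τ := by
    rw [hA, zero_sub, neg_nonneg]
    exact mul_nonpos_of_nonneg_of_nonpos hy₀ (impulse_neg T hb hτ).le
  obtain ⟨t, ht, h⟩ := intermediate_value_Icc hτ.1.le hx ⟨h1.le, h2⟩
  have hne : t ≠ Real.pi / b := by
    rintro rfl
    exact h1.ne h
  have ht' : t ∈ Ioc (Real.pi / b) τ := ⟨lt_of_le_of_ne ht.1 hne.symm, ht.2⟩
  refine ⟨t, ht', ?_⟩
  rw [startOf, div_eq_iff (impulse_neg T hb ⟨ht'.1, ht'.2.trans_lt hτ.2⟩).ne]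
  exact sub_eq_zero.1 h

lemma analyticAt_startOf (T D a : ℝ) (hB : impulse T b t ≠ 0) :
    AnalyticAt ℝ (startOf T D a b) t := by
  have h1 : AnalyticAt ℝ (impulse T b) t := by unfold impulse; fun_prop
  have h2 : AnalyticAt ℝ (impulseDeriv T b) t := by unfold impulseDeriv; fun_prop
  have h3 : AnalyticAt ℝ (originOrbit T D a b) t := by unfold originOrbit; fun_prop
  exact h3.div h1 hB

lemma analyticAt_returnOf (T D a : ℝ) (hB : impulse T b t ≠ 0) :
    AnalyticAt ℝ (returnOf T D a b) t := by
  have h1 : AnalyticAt ℝ (impulse T b) t := by unfold impulse; fun_prop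
  have h2 : AnalyticAt ℝ (impulseDeriv T b) t := by unfold impulseDeriv; fun_prop
  have h3 := analyticAt_startOf T D a hB
  unfold returnOf
  fun_prop

/-- Near every point of its domain the half-map is given by an analytic function, defined on both
sides, which solves the differential equation of the half-map. -/
lemma exists_analyticAt_extension (ha : a < 0) (hT : 0 < T) (hb : 0 < b)
    (hD : D = T ^ 2 / 4 + b ^ 2) (ht : t ∈ Ioo (Real.pi / b) (2 * Real.pi / b)) :
    ∃ P P' : ℝ → ℝ, AnalyticAt ℝ P (startOf T D a b t) ∧
      P (startOf T D a b t) = returnOf T D a b t ∧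
      ∀ᶠ y in 𝓝 (startOf T D a b t), (0 ≤ y → leftHalfMap T D a y = P y) ∧
        HasDerivAt P (P' y) y ∧ P' y * P y * polyW T D a y = y * polyW T D a (P y) := by
  have hB := (impulse_neg T hb ht).ne
  have hd := hasDerivAt_startOf a hb.ne' hD hB
  have hd0 : deriv (startOf T D a b) t ≠ 0 := by
    rw [hd.deriv]
    exact div_ne_zero (neg_ne_zero.2 (returnOf_neg ha hT hb hD ht).ne) hB
  have hf := analyticAt_startOf T D a hB
  set s := hf.hasStrictDerivAt.localInverse _ _ _ hd0
  have hsa : AnalyticAt ℝ s (startOf T D a b t) := hf.analyticAt_localInverse hd0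
  have hs0 : s (startOf T D a b t) = t := HasStrictFDerivAt.localInverse_apply_image ..
  have hright : ∀ᶠ y in 𝓝 (startOf T D a b t), startOf T D a b (s y) = y :=
    HasStrictDerivAt.eventually_right_inverse ..
  have hmem : ∀ᶠ y in 𝓝 (startOf T D a b t), s y ∈ Ioo (Real.pi / b) (2 * Real.pi / b) :=
    hsa.continuousAt.eventually_mem (by rw [hs0]; exact isOpen_Ioo.mem_nhds ht)
  refine ⟨fun y => returnOf T D a b (s y), fun y => y * Real.exp (T * s y) / returnOf T D a b (s y),
    ?_, congrArg _ hs0, ?_⟩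
  · have hg := analyticAt_returnOf T D a hB
    rw [← hs0] at hg
    exact hg.comp hsa
  -- `f (s y) = y` is needed on a neighbourhood of each `y`, in order to differentiate it there.
  · filter_upwards [hright.eventually_nhds, hmem, hsa.eventually_analyticAt] with y hy hyJ hya
    have hy0 : startOf T D a b (s y) = y := hy.self_of_nhds
    have hBy := (impulse_neg T hb hyJ).ne
    have hgy := (returnOf_neg ha hT hb hD hyJ).ne
    refine ⟨fun h => ?_, ?_, ?_⟩
    · conv_lhs => rw [← hy0]
      exact leftHalfMap_startOf ha hT hb hD hyJ (hy0.symm ▸ h)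
    · have hsy := hya.differentiableAt.hasDerivAt
      have h1 : -returnOf T D a b (s y) / impulse T b (s y) * deriv s y = 1 :=
        ((hasDerivAt_startOf a hb.ne' hD hBy).comp y hsy).unique
          ((hasDerivAt_id y).congr_of_eventuallyEq hy)
      refine ((hasDerivAt_returnOf a hb.ne' hD hBy).comp y hsy).congr_deriv ?_
      rw [hy0]
      field_simp at h1 ⊢
      linear_combination y * h1
    · rw [polyW_returnOf a hb.ne' hD hBy, hy0]
      field_simp

/-- The return point is largest for the orbit of the origin. -/
lemma returnOf_le {τ : ℝ} (ha : a < 0) (hT : 0 < T) (hb : 0 < b) (hD : D = T ^ 2 / 4 + b ^ 2)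
    (hτ : τ ∈ Ioo (Real.pi / b) (2 * Real.pi / b)) (hA : originOrbit T D a b τ = 0)
    (ht : t ∈ Ioc (Real.pi / b) τ) : returnOf T D a b t ≤ returnOf T D a b τ := by
  have hJ : ∀ s ∈ Ioc (Real.pi / b) τ, s ∈ Ioo (Real.pi / b) (2 * Real.pi / b) := fun s hs =>
    ⟨hs.1, hs.2.trans_lt hτ.2⟩
  have hd : ∀ s ∈ Ioc (Real.pi / b) τ, HasDerivAt (returnOf T D a b)
      (-startOf T D a b s * Real.exp (T * s) / impulse T b s) s := fun s hs =>
    hasDerivAt_returnOf a hb.ne' hD (impulse_neg T hb (hJ s hs)).ne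
  have hmono : MonotoneOn (returnOf T D a b) (Ioc (Real.pi / b) τ) := by
    refine monotoneOn_of_hasDerivWithinAt_nonneg (convex_Ioc _ _)
      (fun s hs => (hd s hs).continuousAt.continuousWithinAt)
      (fun s hs => (hd s (interior_subset hs)).hasDerivWithinAt) fun s hs => ?_
    have hs' := interior_subset hs
    -- `f` decreases to `f τ = 0`, so it is nonnegative up to `τ`; with `B < 0` this gives `g' ≥ 0`.
    have h0 : 0 ≤ startOf T D a b s := by
      have := (strictAntiOn_startOf ha hT hb hD).antitoneOn (hJ s hs') hτ hs'.2
      rwa [startOf, hA, zero_div] at this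
    refine div_nonneg_of_nonpos ?_ (impulse_neg T hb (hJ s hs')).le
    rw [neg_mul, neg_nonpos]
    positivity
  exact hmono ht ⟨hτ.1, le_rfl⟩ ht.2

end HalfMap

/-! ### Assembly -/

theorem proposition2 (T D a y₁ : ℝ) (haD : a ^ 2 + D ^ 2 ≠ 0)
    (h0 : (0 : ℝ) ∈ leftHalfMapDomain T D a)
    (hP : leftHalfMap T D a 0 = y₁) (hy₁ : y₁ < 0) :
    a < 0 ∧ 0 < T ∧ 0 < 4 * D - T ^ 2 ∧
    -- `I` is an interval that contains a right neighbourhood of the origin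
    (leftHalfMapDomain T D a).OrdConnected ∧ leftHalfMapDomain T D a ∈ 𝓝[≥] (0 : ℝ) ∧
    -- `P(I)` is an interval with right endpoint `y₁`
    (leftHalfMap T D a '' leftHalfMapDomain T D a).OrdConnected ∧
    IsGreatest (leftHalfMap T D a '' leftHalfMapDomain T D a) y₁ ∧
    -- `P` is real analytic in `I`
    AnalyticOn ℝ (leftHalfMap T D a) (leftHalfMapDomain T D a) ∧
    -- the Taylor expansion around the origin
    (fun y₀ : ℝ => leftHalfMap T D a y₀ - taylorPoly T D a y₁ y₀)
      =O[𝓝[≥] (0 : ℝ)] (fun y₀ : ℝ => y₀ ^ 7) := by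
  -- `y₁ < 0` excludes the default value `0`, so the origin truly returns.
  obtain ⟨τ, hret⟩ : ∃ τ, IsLeftReturn T D a 0 τ y₁ := by
    by_cases hex : ∃ y₁ τ, IsLeftReturn T D a 0 τ y₁
    · obtain ⟨z, τ, hz⟩ := hex
      rw [hz.leftHalfMap_eq] at hP
      exact ⟨τ, hP ▸ hz⟩
    · rw [leftHalfMap, dif_neg hex] at hP
      exact absurd hP.symm hy₁.ne
  have hTD : 0 < 4 * D - T ^ 2 := by
    by_contra! h
    exact not_isLeftReturn_zero_of_sq_ge (by linarith) hret
  obtain ⟨b, hb, hD⟩ : ∃ b, 0 < b ∧ D = T ^ 2 / 4 + b ^ 2 := by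
    refine ⟨√(4 * D - T ^ 2) / 2, by positivity, ?_⟩
    rw [div_pow, Real.sq_sqrt hTD.le]
    ring
  obtain ⟨ha, hT, hτ, hA⟩ := parameters_of_isLeftReturn_zero hb hD hret hy₁
  have hJ : ∀ s ∈ Ioc (Real.pi / b) τ, s ∈ Ioo (Real.pi / b) (2 * Real.pi / b) := fun s hs =>
    ⟨hs.1, hs.2.trans_lt hτ.2⟩
  have hsurj : ∀ y, 0 ≤ y → ∃ t ∈ Ioc (Real.pi / b) τ, startOf T D a b t = y := fun y hy =>
    exists_startOf_eq ha hb hD hτ hA hy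
  have hdom : leftHalfMapDomain T D a = Ici 0 := by
    refine Subset.antisymm (fun y hy => hy.1) fun y hy => ⟨hy, Or.inl ?_⟩
    obtain ⟨t, ht, rfl⟩ := hsurj y hy
    exact ⟨_, _, isLeftReturn_startOf ha hT hb hD (hJ t ht) hy⟩
  have hτ0 : startOf T D a b τ = 0 := by rw [startOf, hA, zero_div]
  have hτ1 : returnOf T D a b τ = y₁ := by
    rw [← leftHalfMap_startOf ha hT hb hD hτ hτ0.ge, hτ0, hP]
  have han : AnalyticOn ℝ (leftHalfMap T D a) (Ici 0) := by
    intro y hy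
    obtain ⟨t, ht, rfl⟩ := hsurj y hy
    obtain ⟨P, P', hPa, -, hev⟩ := exists_analyticAt_extension ha hT hb hD (hJ t ht)
    refine hPa.analyticWithinAt.congr_of_eventuallyEq ?_ (hev.self_of_nhds.1 hy)
    filter_upwards [hev.filter_mono nhdsWithin_le_nhds, self_mem_nhdsWithin] with z hz hz0
      using hz.1 hz0
  rw [hdom]
  refine ⟨ha, hT, hTD, ordConnected_Ici, self_mem_nhdsWithin,
    (isPreconnected_Ici.image _ han.continuousOn).ordConnected,
    ⟨⟨0, mem_Ici.2 le_rfl, hP⟩, ?_⟩, han, ?_⟩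
  · rintro _ ⟨y, hy, rfl⟩
    obtain ⟨t, ht, rfl⟩ := hsurj y hy
    rw [leftHalfMap_startOf ha hT hb hD (hJ t ht) hy, ← hτ1]
    exact returnOf_le ha hT hb hD hτ hA ht
  -- The extension at `t = τ` solves the equation on both sides of `0`; the estimate is then
  -- restricted to `y ≥ 0`, where it concerns the half-map.
  · obtain ⟨P, P', -, hP0, hev⟩ := exists_analyticAt_extension ha hT hb hD hτ
    rw [hτ0] at hP0 hev
    have := sub_taylorPoly_isBigO ha.ne hy₁.ne (hP0.trans hτ1) (hev.mono fun y h => h.2.1)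
      (hev.mono fun y h => h.2.2)
    refine (this.mono nhdsWithin_le_nhds).congr' ?_ EventuallyEq.rfl
    filter_upwards [hev.filter_mono nhdsWithin_le_nhds, self_mem_nhdsWithin] with z hz hz0
    rw [hz.1 hz0]
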